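/- Let $n$ be a natural number and let $T=(T_{ijk})_{1\le i,j,k\le n}\in\mathbb{C}^{n\times n\times n}$ be a complex tensor of order 3, with associated trilinear form $t(x,y,z)=\sum_{i,j,k=1}^n T_{ijk}x_iy_jz_k$. A matrix $A\in M_n(\mathbb{C})$ is called orthogonal if $A^TA=\mathrm{Id}_n$ (transpose without complex conjugation). We say that $T$ admits an orthogonal decomposition if there are orthogonal matrices $A,B,C\in M_n(\mathbb{C})$ and $\alpha_1,\dots,\alpha_n\in\mathbb{C}$ such that $t(x,y,z)=g(Ax,By,Cz)$, where $g(x,y,z)=\sum_{i=1}^n\alpha_ix_iy_iz_i$. The $x$-slices $X_1,\dots,X_n$, $y$-slices $Y_1,\dots,Y_n$ and $z$-slices $Z_1,\dots,Z_n$ of $T$ are the $n\times n$ matrices of the bilinear forms $\partial t/\partial x_i$, $\partial t/\partial y_j$, $\partial t/\partial z_k$, i.e. $(X_i)_{jk}=(Y_j)_{ik}=(Z_k)_{ij}=T_{ijk}$. Theorem. The tensor $T$ admits an orthogonal decomposition if and only if the $x$-slices of $T$ satisfy the two conditions (i) for each $k\in\{1,\dots,n\}$, the matrix $X_k^TX_k$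 is diagonalizable and $\operatorname{rank}X_k=\operatorname{rank}X_k^TX_k$; (ii) the matrices $X_kX_l^T$ and $X_k^TX_l$ are symmetric for all $k,l\in\{1,\dots,n\}$; and the $y$-slices $Y_1,\dots,Y_n$ and the $z$-slices $Z_1,\dots,Z_n$ satisfy the same two conditions (with $X$ replaced by $Y$ and by $Z$, respectively). -/

import Mathlib

namespace OrthTensor

/-- A tensor of order 3 and size `n` over `K`, given by its entries `T i j k`. -/
abbrev Tensor3 (n : ℕ) (K : Type*) := Fin n → Fin n → Fin n → K

/-- The trilinear form `t(x, y, z) = ∑ T i j k * x i * y j * z k` of a tensor. -/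
def trilinearForm {n : ℕ} {K : Type*} [Field K] (T : Tensor3 n K) (x y z : Fin n → K) : K :=
  ∑ i, ∑ j, ∑ k, T i j k * x i * y j * z k

/-- The diagonal trilinear form `g(x, y, z) = ∑ α i * x i * y i * z i`. -/
def diagForm {n : ℕ} {K : Type*} [Field K] (α : Fin n → K) (x y z : Fin n → K) : K :=
  ∑ i, α i * x i * y i * z i

/-- Orthogonality in the sense `Aᵀ A = Id` (plain transpose, with no conjugation over `ℂ`). -/
def IsOrthogonal {n : ℕ} {K : Type*} [Field K] (A : Matrix (Fin n) (Fin n) K) : Prop :=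
  A.transpose * A = 1

/-- `t(x, y, z) = g(A x, B y, C z)` with `A`, `B`, `C` orthogonal and `g` diagonal.
Forms are compared as functions, which for an infinite field such as `ℂ` is the same as
comparing them as polynomials. -/
def HasOrthogonalDecomposition {n : ℕ} {K : Type*} [Field K] (T : Tensor3 n K) : Prop :=
  ∃ (A B C : Matrix (Fin n) (Fin n) K) (α : Fin n → K),
    IsOrthogonal A ∧ IsOrthogonal B ∧ IsOrthogonal C ∧
      ∀ x y z : Fin n → K,
        trilinearForm T x y z = diagForm α (A.mulVec x) (B.mulVec y) (C.mulVec z)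

/-- The `i`-th `x`-slice: the matrix of the bilinear form `∂t/∂x_i` in `(y, z)`. -/
def xSlice {n : ℕ} {K : Type*} (T : Tensor3 n K) (i : Fin n) : Matrix (Fin n) (Fin n) K :=
  Matrix.of fun j k => T i j k

/-- The `j`-th `y`-slice: the matrix of the bilinear form `∂t/∂y_j` in `(x, z)`. -/
def ySlice {n : ℕ} {K : Type*} (T : Tensor3 n K) (j : Fin n) : Matrix (Fin n) (Fin n) K :=
  Matrix.of fun i k => T i j k

/-- The `k`-th `z`-slice: the matrix of the bilinear form `∂t/∂z_k` in `(x, y)`. -/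
def zSlice {n : ℕ} {K : Type*} (T : Tensor3 n K) (k : Fin n) : Matrix (Fin n) (Fin n) K :=
  Matrix.of fun i j => T i j k

/-- A square matrix is diagonalizable if it is similar over `K` to a diagonal matrix. -/
def IsDiagonalizable {n : ℕ} {K : Type*} [Field K] (M : Matrix (Fin n) (Fin n) K) : Prop :=
  ∃ (P : Matrix (Fin n) (Fin n) K) (d : Fin n → K),
    IsUnit P.det ∧ M = P * Matrix.diagonal d * P⁻¹

/-- Conditions (i) and (ii) on a family of slices `S`. -/
def SliceConditions {n : ℕ} {K : Type*} [Field K]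
    (S : Fin n → Matrix (Fin n) (Fin n) K) : Prop :=
  (∀ k, IsDiagonalizable ((S k).transpose * S k) ∧
      (S k).rank = ((S k).transpose * S k).rank) ∧
    (∀ k l, (S k * (S l).transpose).IsSymm ∧ ((S k).transpose * S l).IsSymm)

end OrthTensor

open Matrix

namespace OrthTensor

variable {n : ℕ}

/-! ### Simultaneous singular value decompositions and the forward direction -/

section Field

variable {K : Type*} [Field K]

/-! A decomposition makes all slices in one direction equal to `Bᵀ * diagonal (d k) * C` with common
orthogonal `B`, `C`, and such families satisfy (i) and (ii).

Conversely, (ii) makes the products `(S k)ᵀ * S l` symmetric and commuting. Diagonalizability for `k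
= l` and the rank condition force them all to be scalar on joint generalized eigenspaces, which are
therefore mutually orthogonal and supply an orthonormal eigenbasis. The images of each basis vector
under all `S k` are proportional, which yields the common decomposition
(`SliceConditions.exists_svd`).

For the `x`-slices this writes `T` as a sum of `u i ⊗ B i ⊗ C i`. Contracting the `y`-slices with `B
i` gives `u i (C i)ᵀ`; the decomposition of the `y`-slices then makes the `u i` pairwise orthogonal,
and zero when isotropic. Normalizing them gives `A`. -/

theorem isOrthogonal_of_iff {c : Fin n → Fin n → K} :
    IsOrthogonal (Matrix.of c) ↔ ∀ i j, c i ⬝ᵥ c j = if i = j then 1 else 0 := by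
  unfold IsOrthogonal
  rw [mul_eq_one_comm, ← Matrix.ext_iff]
  simp [Matrix.mul_apply, dotProduct, Matrix.one_apply]

theorem IsOrthogonal.mul_transpose {A : Matrix (Fin n) (Fin n) K} (h : IsOrthogonal A) :
    A * Aᵀ = 1 := mul_eq_one_comm.mp h

theorem IsOrthogonal.row_dotProduct {A : Matrix (Fin n) (Fin n) K} (h : IsOrthogonal A)
    (i j : Fin n) : A i ⬝ᵥ A j = if i = j then 1 else 0 :=
  isOrthogonal_of_iff.mp h i j

theorem IsOrthogonal.isUnit_det {A : Matrix (Fin n) (Fin n) K} (h : IsOrthogonal A) :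
    IsUnit A.det :=
  (Matrix.isUnit_iff_isUnit_det A).mp (IsUnit.of_mul_eq_one _ h.mul_transpose)

theorem IsOrthogonal.isUnit_det_transpose {A : Matrix (Fin n) (Fin n) K} (h : IsOrthogonal A) :
    IsUnit Aᵀ.det := by
  simpa using h.isUnit_det

theorem transpose_mul_diagonal_mul_apply (B C : Matrix (Fin n) (Fin n) K) (d : Fin n → K)
    (j k : Fin n) : (Bᵀ * diagonal d * C) j k = ∑ i, d i * B i j * C i k := by
  rw [Matrix.mul_apply]
  simp only [Matrix.mul_diagonal, transpose_apply]
  exact Finset.sum_congr rfl fun i _ => by ring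

theorem transpose_svd_mul_svd {B C : Matrix (Fin n) (Fin n) K} (hB : IsOrthogonal B)
    (d e : Fin n → K) :
    (Bᵀ * diagonal d * C)ᵀ * (Bᵀ * diagonal e * C) =
      Cᵀ * diagonal (fun i => d i * e i) * C := by
  rw [← diagonal_mul_diagonal]
  simp only [transpose_mul, transpose_transpose, diagonal_transpose, Matrix.mul_assoc]
  rw [← Matrix.mul_assoc B, hB.mul_transpose, Matrix.one_mul]

theorem svd_mul_transpose_svd {B C : Matrix (Fin n) (Fin n) K} (hC : IsOrthogonal C)
    (d e : Fin n → K) :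
    (Bᵀ * diagonal d * C) * (Bᵀ * diagonal e * C)ᵀ =
      Bᵀ * diagonal (fun i => d i * e i) * B := by
  rw [← diagonal_mul_diagonal]
  simp only [transpose_mul, transpose_transpose, diagonal_transpose, Matrix.mul_assoc]
  rw [← Matrix.mul_assoc C, hC.mul_transpose, Matrix.one_mul]

theorem isSymm_transpose_mul_diagonal_mul (B : Matrix (Fin n) (Fin n) K) (d : Fin n → K) :
    (Bᵀ * diagonal d * B).IsSymm := by
  simp [Matrix.IsSymm, transpose_mul, Matrix.mul_assoc]

theorem rank_svd {B C : Matrix (Fin n) (Fin n) K} (hB : IsOrthogonal B) (hC : IsOrthogonal C)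
    (d : Fin n → K) : (Bᵀ * diagonal d * C).rank = (diagonal d).rank := by
  rw [rank_mul_eq_left_of_isUnit_det _ _ hC.isUnit_det,
    rank_mul_eq_right_of_isUnit_det _ _ hB.isUnit_det_transpose]

/-- A family of matrices with a simultaneous orthogonal singular value decomposition satisfies
the slice conditions. -/
theorem sliceConditions_svd {B C : Matrix (Fin n) (Fin n) K} (hB : IsOrthogonal B)
    (hC : IsOrthogonal C) (d : Fin n → Fin n → K) :
    SliceConditions fun k => Bᵀ * diagonal (d k) * C := by
  classical
  refine ⟨fun k => ⟨⟨Cᵀ, fun i => d k i * d k i, hC.isUnit_det_transpose, ?_⟩, ?_⟩,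
    fun k l => ⟨?_, ?_⟩⟩
  · rw [transpose_svd_mul_svd hB, Matrix.inv_eq_right_inv hC]
  · rw [transpose_svd_mul_svd hB, rank_svd hB hC, rank_svd hC hC, rank_diagonal, rank_diagonal]
    simp
  · rw [svd_mul_transpose_svd hC]
    exact isSymm_transpose_mul_diagonal_mul _ _
  · rw [transpose_svd_mul_svd hB]
    exact isSymm_transpose_mul_diagonal_mul _ _

theorem trilinearForm_single (T : Tensor3 n K) (i j k : Fin n) :
    trilinearForm T (Pi.single i 1) (Pi.single j 1) (Pi.single k 1) = T i j k := by
  simp [trilinearForm, Pi.single_apply]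

theorem trilinearForm_eq_diagForm_iff (T : Tensor3 n K) (A B C : Matrix (Fin n) (Fin n) K)
    (α : Fin n → K) :
    (∀ x y z, trilinearForm T x y z = diagForm α (A *ᵥ x) (B *ᵥ y) (C *ᵥ z)) ↔
      ∀ i j k, T i j k = ∑ m, α m * A m i * B m j * C m k := by
  constructor
  · intro h i j k
    rw [← trilinearForm_single T, h]
    simp [diagForm]
  · intro h x y z
    have hm (m : Fin n) : α m * (A *ᵥ x) m * (B *ᵥ y) m * (C *ᵥ z) m =
        ∑ i, ∑ j, ∑ k, α m * A m i * B m j * C m k * x i * y j * z k := by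
      simp only [mulVec, dotProduct, Finset.mul_sum, Finset.sum_mul]
      refine (Finset.sum_congr rfl fun k _ => Finset.sum_comm).trans ?_
      rw [Finset.sum_comm]
      refine Finset.sum_congr rfl fun i _ => ?_
      rw [Finset.sum_comm]
      exact Finset.sum_congr rfl fun j _ => Finset.sum_congr rfl fun k _ => by ring
    simp only [trilinearForm, diagForm, hm, h, Finset.sum_mul]
    exact (Finset.sum_congr rfl fun i _ =>
      (Finset.sum_congr rfl fun j _ => Finset.sum_comm).trans Finset.sum_comm).trans Finset.sum_comm

theorem HasOrthogonalDecomposition.sliceConditions {T : Tensor3 n K}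
    (h : HasOrthogonalDecomposition T) :
    SliceConditions (xSlice T) ∧ SliceConditions (ySlice T) ∧ SliceConditions (zSlice T) := by
  obtain ⟨A, B, C, α, hA, hB, hC, h⟩ := h
  rw [trilinearForm_eq_diagForm_iff] at h
  refine ⟨?_, ?_, ?_⟩
  · convert sliceConditions_svd hB hC fun k m => α m * A m k using 1
    ext k i j
    rw [transpose_mul_diagonal_mul_apply]
    exact h k i j
  · convert sliceConditions_svd hA hC fun k m => α m * B m k using 1
    ext k i j
    rw [transpose_mul_diagonal_mul_apply]
    exact (h i k j).trans (Finset.sum_congr rfl fun m _ => by ring)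
  · convert sliceConditions_svd hA hB fun k m => α m * C m k using 1
    ext k i j
    rw [transpose_mul_diagonal_mul_apply]
    exact (h i j k).trans (Finset.sum_congr rfl fun m _ => by ring)

end Field

/-! ### Orthonormal extension for the complex bilinear dot product -/

section Complex

/-- Orthonormal families of vectors taken from pairwise orthogonal subspaces spanning `ℂⁿ` extend
to orthonormal bases of vectors taken from these subspaces. -/
theorem exists_orthonormal_extension {ι : Type*} (E : ι → Submodule ℂ (Fin n → ℂ))
    (hE : ⨆ χ, E χ = ⊤)
    (hEo : ∀ χ χ', χ ≠ χ' → ∀ v ∈ E χ, ∀ w ∈ E χ', v ⬝ᵥ w = 0)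
    (s : Finset (Fin n)) (c : Fin n → Fin n → ℂ) (hc : ∀ i ∈ s, ∃ χ, c i ∈ E χ)
    (ho : ∀ i ∈ s, ∀ j ∈ s, c i ⬝ᵥ c j = if i = j then 1 else 0) :
    ∃ c' : Fin n → Fin n → ℂ, (∀ i ∈ s, c' i = c i) ∧ (∀ i, ∃ χ, c' i ∈ E χ) ∧
      IsOrthogonal (Matrix.of c') := by
  induction hk : n - s.card generalizing s c with
  | zero =>
    have hs : s = Finset.univ := by
      rw [← Finset.card_eq_iff_eq_univ, Fintype.card_fin]
      have := s.card_le_univ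
      rw [Fintype.card_fin] at this
      omega
    subst hs
    exact ⟨c, fun _ _ => rfl, fun i => hc i (Finset.mem_univ i),
      isOrthogonal_of_iff.mpr fun i j => ho i (Finset.mem_univ i) j (Finset.mem_univ j)⟩
  | succ k ih =>
    obtain ⟨i₀, hi₀⟩ : ∃ i₀, i₀ ∉ s := by
      by_contra! h
      rw [Finset.eq_univ_iff_forall.mpr h, Finset.card_univ, Fintype.card_fin] at hk
      omega
    -- `P` is the projection to the orthogonal complement of the family
    let P (v : Fin n → ℂ) : Fin n → ℂ := v - ∑ i ∈ s, (c i ⬝ᵥ v) • c i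
    have hPc (v) (i) (hi : i ∈ s) : c i ⬝ᵥ P v = 0 := by
      simp only [P, dotProduct_sub, dotProduct_sum, dotProduct_smul]
      rw [Finset.sum_congr rfl fun j hj => by rw [ho i hi j hj]]
      simp [hi]
    have hPadd (v w) : P (v + w) = P v + P w := by
      simp only [P, dotProduct_add, add_smul, Finset.sum_add_distrib]
      abel
    have hPE (χ) (v) (hv : v ∈ E χ) : P v ∈ E χ := by
      refine sub_mem hv (sum_mem fun i hi => ?_)
      obtain ⟨χ', hχ'⟩ := hc i hi
      by_cases h : χ' = χ
      · exact Submodule.smul_mem _ _ (h ▸ hχ')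
      · rw [hEo _ _ h _ hχ' _ hv, zero_smul]
        exact zero_mem _
    -- Otherwise polarization makes the image of `P` totally isotropic, so `P = 0` by nondegeneracy,
    -- and fewer than `n` vectors would span.
    obtain ⟨χ, v, hv, hvv⟩ : ∃ χ, ∃ v ∈ E χ, P v ⬝ᵥ P v ≠ 0 := by
      by_contra! h
      have h1 (χ v χ' w) (hv : v ∈ E χ) (hw : w ∈ E χ') : P v ⬝ᵥ P w = 0 := by
        by_cases hχ : χ = χ'
        · subst hχ
          have h2 := h χ _ (add_mem hv hw)
          rw [hPadd, add_dotProduct, dotProduct_add, dotProduct_add, h χ v hv, h χ w hw,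
            dotProduct_comm (P w)] at h2
          linear_combination h2 / 2
        · exact hEo _ _ hχ _ (hPE _ _ hv) _ (hPE _ _ hw)
      have hP0 : P 0 = 0 := by simp [P]
      have h2 (v w) : P v ⬝ᵥ P w = 0 := by
        have hv : v ∈ ⨆ χ, E χ := hE ▸ Submodule.mem_top
        have hw : w ∈ ⨆ χ, E χ := hE ▸ Submodule.mem_top
        refine Submodule.iSup_induction E (motive := fun v => P v ⬝ᵥ P w = 0) hv
          (fun χ v hv => ?_) (by simp [hP0])
          fun x y hx hy => by rw [hPadd, add_dotProduct, hx, hy, add_zero]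
        exact Submodule.iSup_induction E (motive := fun w => P v ⬝ᵥ P w = 0) hw
          (fun χ' w hw => h1 _ _ _ _ hv hw) (by simp [hP0])
          fun x y hx hy => by rw [hPadd, dotProduct_add, hx, hy, add_zero]
      have h3 (v) : P v = 0 := by
        refine dotProduct_eq_zero _ fun w => ?_
        have hw : w = P w + ∑ i ∈ s, (c i ⬝ᵥ w) • c i := by simp [P]
        rw [hw, dotProduct_add, h2, zero_add, dotProduct_sum]
        refine Finset.sum_eq_zero fun i hi => ?_
        rw [dotProduct_smul, dotProduct_comm (P v), hPc v i hi, smul_zero]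
      have hspan : Submodule.span ℂ (s.image c : Set (Fin n → ℂ)) = ⊤ := by
        refine eq_top_iff.mpr fun v _ => ?_
        rw [sub_eq_zero.mp (h3 v)]
        exact sum_mem fun i hi => Submodule.smul_mem _ _
          (Submodule.subset_span (by simpa using ⟨i, hi, rfl⟩))
      have h4 := finrank_span_finset_le_card (R := ℂ) (s.image c)
      rw [Set.finrank, hspan, finrank_top, Module.finrank_fin_fun] at h4
      have := Finset.card_image_le (s := s) (f := c)
      omega
    obtain ⟨r, hr⟩ := IsAlgClosed.exists_pow_nat_eq (P v ⬝ᵥ P v) two_pos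
    have hr0 : r ≠ 0 := by rintro rfl; simp [← hr] at hvv
    have hne (i) (hi : i ∈ s) : i ≠ i₀ := fun h => hi₀ (h ▸ hi)
    obtain ⟨c', h1, h2, h3⟩ := ih (insert i₀ s) (Function.update c i₀ (r⁻¹ • P v))
      (fun i hi => by
        rcases Finset.mem_insert.mp hi with rfl | hi
        · exact ⟨χ, by simpa using Submodule.smul_mem _ _ (hPE _ _ hv)⟩
        · simpa [hne i hi] using hc i hi)
      (fun i hi j hj => by
        rcases Finset.mem_insert.mp hi with hi | hi <;>
          rcases Finset.mem_insert.mp hj with hj | hj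
        · subst hj
          simp only [hi, Function.update_self, smul_dotProduct, dotProduct_smul, ← hr, if_true,
            smul_eq_mul]
          field_simp
        · simp [hi, hne j hj, (hne j hj).symm, dotProduct_comm _ (c j), hPc v j hj]
        · simp [hj, hne i hi, hPc v i hi]
        · simpa [hne i hi, hne j hj] using ho i hi j hj)
      (by rw [Finset.card_insert_of_notMem hi₀]; omega)
    refine ⟨c', fun i hi => ?_, h2, h3⟩
    rw [h1 i (Finset.mem_insert_of_mem hi), Function.update_of_ne (hne i hi)]

theorem exists_orthogonal_extension (s : Finset (Fin n)) (c : Fin n → Fin n → ℂ)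
    (ho : ∀ i ∈ s, ∀ j ∈ s, c i ⬝ᵥ c j = if i = j then 1 else 0) :
    ∃ A : Matrix (Fin n) (Fin n) ℂ, (∀ i ∈ s, A i = c i) ∧ IsOrthogonal A := by
  obtain ⟨c', h1, -, h2⟩ := exists_orthonormal_extension (fun _ : Unit => ⊤) (by simp)
    (fun χ χ' h => (h (Subsingleton.elim _ _)).elim) s c (fun _ _ => ⟨(), Submodule.mem_top⟩) ho
  exact ⟨Matrix.of c', h1, h2⟩

/-- Pairwise orthogonal vectors, each zero or non-isotropic, are multiples of the rows of an
orthogonal matrix. -/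
theorem exists_orthogonal_eq_smul (u : Fin n → Fin n → ℂ)
    (hu : ∀ i j, i ≠ j → u i ⬝ᵥ u j = 0) (hu0 : ∀ i, u i ⬝ᵥ u i = 0 → u i = 0) :
    ∃ (A : Matrix (Fin n) (Fin n) ℂ) (α : Fin n → ℂ), IsOrthogonal A ∧ ∀ i, u i = α i • A i := by
  classical
  choose r hr using fun i => IsAlgClosed.exists_pow_nat_eq (u i ⬝ᵥ u i) two_pos
  have hr0 (i) : r i = 0 ↔ u i ⬝ᵥ u i = 0 := by simp [← hr]
  obtain ⟨A, hA, hAo⟩ := exists_orthogonal_extension (Finset.univ.filter fun i => r i ≠ 0)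
    (fun i => (r i)⁻¹ • u i) fun i hi j hj => by
      simp only [Finset.mem_filter, Finset.mem_univ, true_and] at hi hj
      split_ifs with h
      · subst h
        simp only [smul_dotProduct, dotProduct_smul, ← hr, smul_eq_mul]
        field_simp
      · simp [hu i j h]
  refine ⟨A, r, hAo, fun i => ?_⟩
  by_cases h : r i = 0
  · rw [h, zero_smul]
    exact hu0 i ((hr0 i).mp h)
  · rw [hA i (by simpa using h), smul_inv_smul₀ h]

/-! ### Joint eigenvectors and simultaneous decomposition -/

/-- The kernels are nested, and rank-nullity gives them equal dimension. -/
theorem mulVec_eq_zero_of_rank_eq {X : Matrix (Fin n) (Fin n) ℂ} (h : X.rank = (Xᵀ * X).rank)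
    {v : Fin n → ℂ} (hv : (Xᵀ * X) *ᵥ v = 0) : X *ᵥ v = 0 := by
  have hle : LinearMap.ker X.mulVecLin ≤ LinearMap.ker (Xᵀ * X).mulVecLin := fun w hw => by
    simp only [LinearMap.mem_ker, mulVecLin_apply] at hw ⊢
    rw [← mulVec_mulVec, hw, mulVec_zero]
  have h1 := X.mulVecLin.finrank_range_add_finrank_ker
  have h2 := (Xᵀ * X).mulVecLin.finrank_range_add_finrank_ker
  have heq := Submodule.eq_of_le_of_finrank_eq hle (by
    unfold Matrix.rank at h
    omega)
  have : v ∈ LinearMap.ker X.mulVecLin := heq ▸ hv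
  exact this

theorem IsDiagonalizable.eigenvector_of_sq {M : Matrix (Fin n) (Fin n) ℂ}
    (hM : IsDiagonalizable M) {μ : ℂ} {v : Fin n → ℂ}
    (h : (M - μ • 1) *ᵥ ((M - μ • 1) *ᵥ v) = 0) : (M - μ • 1) *ᵥ v = 0 := by
  obtain ⟨P, d, hP, rfl⟩ := hM
  have hM : P * diagonal d * P⁻¹ - μ • 1 = P * diagonal (fun i => d i - μ) * P⁻¹ := by
    have : diagonal (fun i => d i - μ) = diagonal d - μ • (1 : Matrix (Fin n) (Fin n) ℂ) := by
      rw [smul_one_eq_diagonal, diagonal_sub]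
    rw [this, Matrix.mul_sub, Matrix.sub_mul, Matrix.mul_smul, Matrix.smul_mul, Matrix.mul_one,
      mul_nonsing_inv _ hP]
  rw [hM] at h ⊢
  have h1 : diagonal (fun i => d i - μ) *ᵥ (diagonal (fun i => d i - μ) *ᵥ (P⁻¹ *ᵥ v)) = 0 := by
    have := congrArg (P⁻¹ *ᵥ ·) h
    simpa [mulVec_mulVec, Matrix.mul_assoc, nonsing_inv_mul_cancel_left _ _ hP] using this
  rw [← mulVec_mulVec, ← mulVec_mulVec]
  suffices diagonal (fun i => d i - μ) *ᵥ (P⁻¹ *ᵥ v) = 0 by rw [this, mulVec_zero]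
  funext i
  have := congrFun h1 i
  simp only [mulVec_diagonal, Pi.zero_apply] at this ⊢
  rcases mul_eq_zero.mp this with h | h
  · rw [h, zero_mul]
  · exact h

/-- On an invariant subspace where `f` has no generalized eigenvectors of rank two, generalized
eigenvectors are eigenvectors. -/
theorem apply_eq_smul_of_mem_maxGenEigenspace {V : Type*} [AddCommGroup V] [Module ℂ V]
    {f : Module.End ℂ V} {W : Submodule ℂ V} {μ : ℂ} (hW : ∀ v ∈ W, f v ∈ W)
    (h : ∀ v ∈ W, (f - μ • 1) ((f - μ • 1) v) = 0 → (f - μ • 1) v = 0) {v : V} (hv : v ∈ W)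
    (hvm : v ∈ f.maxGenEigenspace μ) : f v = μ • v := by
  suffices (f - μ • 1) v = 0 by simpa [sub_eq_zero] using this
  have hW' (v) (hv : v ∈ W) : (f - μ • 1) v ∈ W := by
    simpa using sub_mem (hW v hv) (W.smul_mem μ hv)
  obtain ⟨k, hk⟩ := (Module.End.mem_maxGenEigenspace _ _ _).mp hvm
  induction k generalizing v with
  | zero => rw [show v = 0 by simpa using hk, map_zero]
  | succ k ih =>
    refine h v hv (ih (hW' v hv) ?_ ?_)
    · exact Module.End.mapsTo_maxGenEigenspace_of_comm
        (Algebra.mul_sub_algebraMap_commutes f μ) μ hvm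
    · rwa [pow_succ] at hk

/-- The products `(S k)ᵀ * S l` commute and have a basis of joint eigenvectors that is
orthonormal. -/
theorem SliceConditions.exists_orthonormal_eigenvectors
    {S : Fin n → Matrix (Fin n) (Fin n) ℂ} (hS : SliceConditions S) :
    ∃ (c : Fin n → Fin n → ℂ) (μ : Fin n → Fin n → Fin n → ℂ), IsOrthogonal (Matrix.of c) ∧
      ∀ i k l, ((S k)ᵀ * S l) *ᵥ c i = μ i k l • c i := by
  obtain ⟨h1, h2⟩ := hS
  have hsy (k l) : (S k)ᵀ * S l = (S l)ᵀ * S k := by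
    simpa [Matrix.IsSymm, transpose_mul] using (h2 l k).2
  have hsy' (k l) : S k * (S l)ᵀ = S l * (S k)ᵀ := by
    simpa [Matrix.IsSymm, transpose_mul] using (h2 l k).1
  -- Symmetry of `S l * (S p)ᵀ` exchanges the two inner indices.
  have hswap (k l p q) : (S k)ᵀ * S l * ((S p)ᵀ * S q) = (S k)ᵀ * S p * ((S l)ᵀ * S q) := by
    simp only [Matrix.mul_assoc]
    rw [← Matrix.mul_assoc (S l), hsy' l p, Matrix.mul_assoc]
  have hcomm (k l p q) : (S k)ᵀ * S l * ((S p)ᵀ * S q) = (S p)ᵀ * S q * ((S k)ᵀ * S l) := by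
    rw [hswap p q k l, hsy p k, hsy q l, ← hswap k l p q]
  let f (p : Fin n × Fin n) : Module.End ℂ (Fin n → ℂ) := toLin' ((S p.1)ᵀ * S p.2)
  have hf (p q) : Commute (f p) (f q) := by
    change toLin' _ * toLin' _ = toLin' _ * toLin' _
    rw [Module.End.mul_eq_comp, Module.End.mul_eq_comp, ← toLin'_mul, ← toLin'_mul, hcomm]
  let E (χ : Fin n × Fin n → ℂ) := ⨅ p, (f p).maxGenEigenspace (χ p)
  have hE : ⨆ χ, E χ = ⊤ :=
    Module.End.iSup_iInf_maxGenEigenspace_eq_top_of_iSup_maxGenEigenspace_eq_top_of_commute f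
      (fun p q _ => hf p q) fun p => Module.End.iSup_maxGenEigenspace_eq_top _
  have hEf (χ p v) (hv : v ∈ E χ) : f p v ∈ E χ := by
    simp only [E, Submodule.mem_iInf] at hv ⊢
    exact fun q => Module.End.mapsTo_maxGenEigenspace_of_comm (hf q p) _ (hv q)
  have hsub (k l) (μ : ℂ) (v) : (f (k, l) - μ • 1) v = ((S k)ᵀ * S l - μ • 1) *ᵥ v := by
    simp [f, sub_mulVec, smul_mulVec]
  have hdiag (χ k v) (hv : v ∈ E χ) : ((S k)ᵀ * S k) *ᵥ v = χ (k, k) • v := by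
    refine apply_eq_smul_of_mem_maxGenEigenspace (f := f (k, k)) (hEf χ (k, k)) (fun w _ hw => ?_)
      hv (by simpa only [E, Submodule.mem_iInf] using (Submodule.mem_iInf _).mp hv (k, k))
    rw [hsub, hsub] at hw
    rw [hsub]
    exact (h1 k).1.eigenvector_of_sq hw
  have hker (χ k v) (hv : v ∈ E χ) (h0 : χ (k, k) = 0) : S k *ᵥ v = 0 :=
    mulVec_eq_zero_of_rank_eq (h1 k).2 (by rw [hdiag χ k v hv, h0, zero_smul])
  have hall (χ k l v) (hv : v ∈ E χ) : ((S k)ᵀ * S l) *ᵥ v = χ (k, l) • v := by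
    refine apply_eq_smul_of_mem_maxGenEigenspace (f := f (k, l)) (hEf χ (k, l)) (fun w hwE hw => ?_)
      hv ((Submodule.mem_iInf _).mp hv (k, l))
    generalize χ (k, l) = μ at hw ⊢
    -- By `hswap`, the square of a mixed product is a product of two unmixed ones, already known to
    -- be scalar here.
    have hsq : f (k, l) (f (k, l) w) = (χ (k, k) * χ (l, l)) • w := by
      have : (S k)ᵀ * S l * ((S k)ᵀ * S l) = (S k)ᵀ * S k * ((S l)ᵀ * S l) := hswap _ _ _ _
      simp only [f, toLin'_apply, mulVec_mulVec, this]
      rw [← mulVec_mulVec, hdiag χ l w hwE, mulVec_smul, hdiag χ k w hwE, smul_smul, mul_comm]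
    have hzero (h0 : χ (k, k) * χ (l, l) = 0) : f (k, l) w = 0 := by
      simp only [f, toLin'_apply]
      rcases mul_eq_zero.mp h0 with h0 | h0
      · rw [hsy, ← mulVec_mulVec, hker χ k w hwE h0, mulVec_zero]
      · rw [← mulVec_mulVec, hker χ l w hwE h0, mulVec_zero]
    generalize χ (k, k) * χ (l, l) = s at hsq hzero
    generalize f (k, l) = g at hsq hzero hw ⊢
    simp only [LinearMap.sub_apply, LinearMap.smul_apply, Module.End.one_apply, map_sub, map_smul,
      hsq] at hw ⊢
    by_cases hμ : μ = 0
    · subst hμ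
      rcases smul_eq_zero.mp (show s • w = 0 by simpa using hw) with h0 | h0
      · simp [hzero h0]
      · simp [h0]
    -- Expanding `(g - μ)² w = 0` with `g² w = s • w` gives `2μ g w = (s + μ²) w`; applying `g`
    -- twice then forces `(s - μ²)² = 0` unless `w = 0`.
    · have hg : g w = ((s + μ * μ) / (2 * μ)) • w := by
        rw [div_eq_inv_mul, mul_smul, eq_inv_smul_iff₀ (by simpa using hμ)]
        linear_combination (norm := module) (-1 : ℂ) • hw
      have hg2 : ((s + μ * μ) / (2 * μ)) * ((s + μ * μ) / (2 * μ)) = s ∨ w = 0 := by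
        have h3 := hsq
        rw [hg, map_smul, hg, smul_smul, ← sub_eq_zero, ← sub_smul, smul_eq_zero,
          sub_eq_zero] at h3
        exact h3
      rcases hg2 with hg2 | rfl
      · have : s = μ * μ := by
          field_simp at hg2
          have h4 : (s - μ * μ) ^ 2 = 0 := by linear_combination hg2
          exact sub_eq_zero.mp (pow_eq_zero_iff two_ne_zero |>.mp h4)
        rw [hg, this, ← sub_smul, show (μ * μ + μ * μ) / (2 * μ) - μ = 0 by field_simp; ring,
          zero_smul]
      · simp
  have hEo (χ χ') (hne : χ ≠ χ') (v) (hv : v ∈ E χ) (w) (hw : w ∈ E χ') : v ⬝ᵥ w = 0 := by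
    obtain ⟨⟨k, l⟩, hkl⟩ := Function.ne_iff.mp hne
    have h3 : (((S k)ᵀ * S l) *ᵥ v) ⬝ᵥ w = v ⬝ᵥ (((S k)ᵀ * S l) *ᵥ w) := by
      rw [dotProduct_mulVec, ← mulVec_transpose, transpose_mul, transpose_transpose, hsy l k]
    rw [hall χ k l v hv, hall χ' k l w hw, smul_dotProduct, dotProduct_smul, ← sub_eq_zero,
      ← sub_smul, smul_eq_zero] at h3
    exact h3.resolve_left (sub_ne_zero.mpr hkl)
  obtain ⟨c, -, hc, hco⟩ := exists_orthonormal_extension E hE hEo ∅ 0 (by simp) (by simp)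
  choose χ hχ using hc
  exact ⟨c, fun i k l => χ i (k, l), hco, fun i k l => hall _ k l _ (hχ i)⟩

/-- Simultaneous orthogonal singular value decomposition of a family satisfying the slice
conditions. -/
theorem SliceConditions.exists_svd {S : Fin n → Matrix (Fin n) (Fin n) ℂ}
    (hS : SliceConditions S) :
    ∃ (B C : Matrix (Fin n) (Fin n) ℂ) (d : Fin n → Fin n → ℂ), IsOrthogonal B ∧
      IsOrthogonal C ∧ ∀ k, S k = Bᵀ * diagonal (d k) * C := by
  classical
  obtain ⟨c, μ, hc, hμ⟩ := hS.exists_orthonormal_eigenvectors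
  obtain ⟨h1, h2⟩ := hS
  have hcc := isOrthogonal_of_iff.mp hc
  have hinner (i j k l) : (S k *ᵥ c i) ⬝ᵥ (S l *ᵥ c j) = if i = j then μ j k l else 0 := by
    rw [← vecMul_transpose, ← dotProduct_mulVec, mulVec_mulVec, hμ, dotProduct_smul, hcc]
    simp
  have hzero (i k) (h0 : μ i k k = 0) : S k *ᵥ c i = 0 :=
    mulVec_eq_zero_of_rank_eq (h1 k).2 (by rw [hμ, h0, zero_smul])
  -- Both sides equal `S l * (S k)ᵀ * S k` applied to `c i`, by the two symmetries.
  have hprop (i k l) : μ i k k • S l *ᵥ c i = μ i k l • S k *ᵥ c i := by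
    have hsy : (S k)ᵀ * S l = (S l)ᵀ * S k := by
      simpa [Matrix.IsSymm, transpose_mul] using (h2 l k).2
    have hsy' : S k * (S l)ᵀ = S l * (S k)ᵀ := by
      simpa [Matrix.IsSymm, transpose_mul] using (h2 l k).1
    rw [← mulVec_smul, ← mulVec_smul, ← hμ, ← hμ, mulVec_mulVec, mulVec_mulVec, hsy,
      ← Matrix.mul_assoc, ← Matrix.mul_assoc, hsy']
  let s : Finset (Fin n) := Finset.univ.filter fun i => ∃ k, μ i k k ≠ 0
  have hk (i) : ∃ k, i ∈ s → μ i k k ≠ 0 := by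
    by_cases hi : i ∈ s
    · obtain ⟨k, hk⟩ := (Finset.mem_filter.mp hi).2
      exact ⟨k, fun _ => hk⟩
    -- Outside `s` the index is arbitrary.
    · exact ⟨i, fun h => (hi h).elim⟩
  choose k hk using hk
  choose r hr using fun i => IsAlgClosed.exists_pow_nat_eq (μ i (k i) (k i)) two_pos
  have hr0 (i) (hi : i ∈ s) : r i ≠ 0 := fun h => hk i hi (by simp [← hr, h])
  obtain ⟨B, hB, hBo⟩ := exists_orthogonal_extension s (fun i => (r i)⁻¹ • S (k i) *ᵥ c i)
    fun i hi j hj => by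
      have := hr0 i hi
      rw [smul_dotProduct, dotProduct_smul, hinner]
      split_ifs with h
      · subst h
        rw [← hr, smul_eq_mul, smul_eq_mul]
        field_simp
      · simp
  have hSc (i l) : ∃ d : ℂ, S l *ᵥ c i = d • B i := by
    by_cases hi : i ∈ s
    · refine ⟨(μ i (k i) (k i))⁻¹ * μ i (k i) l * r i, ?_⟩
      rw [hB i hi, smul_smul, mul_assoc, mul_assoc, mul_inv_cancel₀ (hr0 i hi), mul_one, mul_smul,
        ← hprop, inv_smul_smul₀ (hk i hi)]
    · refine ⟨0, ?_⟩
      simp only [s, Finset.mem_filter, Finset.mem_univ, true_and, not_exists, not_not] at hi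
      rw [hzero i l (hi l), zero_smul]
  choose d hd using hSc
  refine ⟨B, Matrix.of c, fun l i => d i l, hBo, hc, fun l => ?_⟩
  have h3 : S l * (Matrix.of c)ᵀ = Bᵀ * diagonal fun i => d i l := by
    ext p i
    rw [Matrix.mul_diagonal, transpose_apply]
    simpa [mul_comm, Matrix.mul_apply, mulVec, dotProduct] using congrFun (hd i l) p
  rw [← h3, Matrix.mul_assoc, show (Matrix.of c)ᵀ * Matrix.of c = 1 from hc, Matrix.mul_one]

/-! ### Assembling the decomposition -/

theorem hasOrthogonalDecomposition_of_sliceConditions {T : Tensor3 n ℂ}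
    (hx : SliceConditions (xSlice T)) (hy : SliceConditions (ySlice T)) :
    HasOrthogonalDecomposition T := by
  obtain ⟨B, C, d, hB, hC, hT⟩ := hx.exists_svd
  obtain ⟨A', C', e, hA', hC', hT'⟩ := hy.exists_svd
  have hTe (k p q) : T k p q = ∑ i, d k i * B i p * C i q := by
    rw [← transpose_mul_diagonal_mul_apply, ← hT]
    rfl
  let u (i k : Fin n) : ℂ := d k i
  let Y (i : Fin n) : Matrix (Fin n) (Fin n) ℂ := ∑ p, B i p • ySlice T p
  have hY (i) : Y i = vecMulVec (u i) (C i) := by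
    ext k q
    simp only [Y, Matrix.sum_apply, Matrix.smul_apply, ySlice, of_apply, hTe, smul_eq_mul,
      Finset.mul_sum]
    rw [Finset.sum_comm]
    have hBm (m) : ∑ p, B i p * (d k m * B m p * C m q) = d k m * C m q * (B i ⬝ᵥ B m) := by
      rw [dotProduct, Finset.mul_sum]
      exact Finset.sum_congr rfl fun p _ => by ring
    simp [hBm, hB.row_dotProduct, vecMulVec_apply, u]
  have hYe (i) : Y i = A'ᵀ * diagonal (fun m => ∑ p, B i p * e p m) * C' := by
    have : diagonal (fun m => ∑ p, B i p * e p m) = ∑ p, B i p • diagonal (e p) := by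
      ext a b
      by_cases h : a = b <;> simp [Matrix.sum_apply, h]
    simp only [Y, hT', this, Matrix.mul_sum, Matrix.sum_mul, Matrix.mul_smul, Matrix.smul_mul]
  have hYY (i j) : (Y i)ᵀ * Y j = (u i ⬝ᵥ u j) • vecMulVec (C i) (C j) := by
    rw [hY, hY, transpose_vecMulVec, vecMulVec_mul_vecMulVec]
    ext
    simp [vecMulVec_apply, mul_left_comm]
  have hu (i j) (hij : i ≠ j) : u i ⬝ᵥ u j = 0 := by
    have h1 : ((Y i)ᵀ * Y j).IsSymm := by
      rw [hYe, hYe, transpose_svd_mul_svd hA']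
      exact isSymm_transpose_mul_diagonal_mul _ _
    -- Pairing the symmetric matrix `(u i ⬝ᵥ u j) • vecMulVec (C i) (C j)` with `C i` and `C j`
    -- isolates the scalar, since the transpose pairs to zero.
    have h2 := congrArg (· *ᵥ C j) h1
    have h3 := congrArg (C i ⬝ᵥ ·) h2
    simpa [hYY, eq_comm, transpose_vecMulVec, smul_mulVec, vecMulVec_mulVec, hC.row_dotProduct, hij] using h3
  have hu0 (i) (hi : u i ⬝ᵥ u i = 0) : u i = 0 := by
    have h1 := hYY i i
    rw [hi, zero_smul, hYe, transpose_svd_mul_svd hA'] at h1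
    -- The squared singular values of `Y i` vanish, hence so does `Y i` itself.
    have h2 : diagonal (fun m => (∑ p, B i p * e p m) * ∑ p, B i p * e p m) = 0 := by
      have h3 := congrArg (fun M => C' * M * C'ᵀ) h1
      simpa only [Matrix.mul_assoc, hC'.mul_transpose, Matrix.mul_one, ← Matrix.mul_assoc C' C'ᵀ,
        Matrix.one_mul, Matrix.zero_mul, Matrix.mul_zero] using h3
    have h3 : (fun m => ∑ p, B i p * e p m) = 0 := by
      funext m
      simpa using congrFun (congrFun h2 m) m
    have h4 := congrArg (· *ᵥ C i) ((hY i).symm.trans (hYe i))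
    simpa [h3, vecMulVec_mulVec, hC.row_dotProduct] using h4
  obtain ⟨A, α, hA, hAu⟩ := exists_orthogonal_eq_smul u hu hu0
  refine ⟨A, B, C, α, hA, hB, hC, (trilinearForm_eq_diagForm_iff T A B C α).mpr fun k p q => ?_⟩
  rw [hTe]
  refine Finset.sum_congr rfl fun m _ => ?_
  rw [show d k m = α m * A m k from congrFun (hAu m) k]

end Complex

end OrthTensor

theorem mainTheorem4 (n : ℕ) (T : OrthTensor.Tensor3 n ℂ) :
    OrthTensor.HasOrthogonalDecomposition T ↔
      OrthTensor.SliceConditions (OrthTensor.xSlice T) ∧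
      OrthTensor.SliceConditions (OrthTensor.ySlice T) ∧
      OrthTensor.SliceConditions (OrthTensor.zSlice T) :=
  ⟨fun h => h.sliceConditions, fun h =>
    OrthTensor.hasOrthogonalDecomposition_of_sliceConditions h.1 h.2.1⟩
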